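/- A group is called an OE-group if it is finitely generated, residually finite and has fewer than two ends (i.e. it is finite or one-ended). Let $H$ and $K$ be finite subgroups of an OE-group $G_1$ that are conjugate in $G_1$. For an isomorphism $f\colon H\to K$ let $\mathrm{HNN}(G_1,H,K,f,t)$ be the HNN-extension of $G_1$ with stable letter $t$ conjugating $H$ to $K$ via $f$. Let $\mathrm{Out}(H)=\mathrm{Aut}(H)/\mathrm{Inn}(H)$, let $\widetilde N_{G_1}(H)\le \mathrm{Out}(H)$ be the image of the normalizer $N_{G_1}(H)$ (acting on $H$ by conjugation), and let $\widetilde{\mathrm{Aut}}_{G_1}(H)\le \mathrm{Out}(H)$ be the image of the group of automorphisms of $G_1$ that leave $H$ invariant. Then the number of isomorphism classes (as abstract groups) of HNN-extensions $\mathrm{HNN}(G_1,H,K,f,t)$, where $f$ ranges over all isomorphisms $H\to K$, equals $$\left|\widetilde N_{G_1}(H)\backslash \mathrm{Out}(H)/\bigl(\widetilde{\mathrm{Aut}}_{G_1}(H)\times C_2\bigr)\right|,$$ where the right-hand side is the number of orbits in $\mathrm{Out}(H)$ of the group of permutations of $\mathrm{Out}(H)$ generated by left multiplications by elements of $\widetilde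 N_{G_1}(H)$, conjugations by elements of $\widetilde{\mathrm{Aut}}_{G_1}(H)$, and the inversion $x\mapsto x^{-1}$ (the action of $C_2$). -/

import Mathlib

/-- An OE-group: a finitely generated, residually finite group with fewer than two ends.
The ends of a finitely generated group are the ends of its Cayley graph with respect to a finite
generating set (their number does not depend on that set). A finite group has no end. -/
structure IsOEGroup (G : Type*) [Group G] : Prop where
  residuallyFinite : Group.ResiduallyFinite G
  exists_ends_lt_two : ∃ S : Finset G, Subgroup.closure (S : Set G) = ⊤ ∧
    (SimpleGraph.mulCayley (S : Set G)).end.encard < 2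

/-- The inner automorphisms of a group form a normal subgroup of its automorphism group. -/
instance innNormal (H : Type*) [Group H] : (MulAut.conj : H →* MulAut H).range.Normal where
  conj_mem := by
    rintro _ ⟨h, rfl⟩ f
    refine ⟨f h, ?_⟩
    ext x
    simp

/-- The outer automorphism group `Out(H) = Aut(H) / Inn(H)`. -/
abbrev OutAut (H : Type*) [Group H] : Type _ :=
  MulAut H ⧸ (MulAut.conj : H →* MulAut H).range

section
variable {G : Type*} [Group G]

/-- The image in `Aut(H)` of the group of all automorphisms of `G` that leave `H` invariant:
the automorphisms of `H` that are restrictions of automorphisms of `G`. -/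
def autBar (H : Subgroup G) : Subgroup (MulAut H) where
  carrier := {β | ∃ α : MulAut G, ∀ h : H, α (h : G) = (β h : G)}
  one_mem' := ⟨1, fun _ => rfl⟩
  mul_mem' := by
    rintro β₁ β₂ ⟨α₁, h₁⟩ ⟨α₂, h₂⟩
    exact ⟨α₁ * α₂, fun h => by rw [MulAut.mul_apply, MulAut.mul_apply, h₂, h₁]⟩
  inv_mem' := by
    rintro β ⟨α, hα⟩
    refine ⟨α⁻¹, fun h => ?_⟩
    have := hα (β⁻¹ h)
    rw [MulAut.apply_inv_self] at this
    rw [← this, MulAut.inv_apply_self]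

/-- The image in `Out(H)` of the group of automorphisms of `G` that leave `H` invariant. -/
def autTilde (H : Subgroup G) : Subgroup (OutAut H) :=
  (autBar H).map (QuotientGroup.mk' _)

/-- The image in `Out(H)` of the normalizer of `H` in `G`, acting on `H` by conjugation. -/
def normalizerTilde (H : Subgroup G) : Subgroup (OutAut H) :=
  H.normalizerMonoidHom.range.map (QuotientGroup.mk' _)

end

/-- For subgroups `N` and `A` of a group `Q`, the group of permutations of `Q` generated by
the left multiplications by elements of `N`, the conjugations by elements of `A`, and the
inversion. -/
def twistedPerms {Q : Type*} [Group Q] (N A : Subgroup Q) : Subgroup (Equiv.Perm Q) :=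
  Subgroup.closure
    ({p | ∃ n ∈ N, p = Equiv.mulLeft n} ∪ {p | ∃ a ∈ A, p = (MulAut.conj a).toEquiv} ∪
      {Equiv.inv Q})

/-- The orbit space `N \ Q / (A × C₂)`, where `N` acts by left multiplication, `A` by conjugation
and `C₂` by inversion. -/
abbrev TwistedOrbits {Q : Type*} [Group Q] (N A : Subgroup Q) : Type _ :=
  MulAction.orbitRel.Quotient (twistedPerms N A) Q

/-- Two isomorphisms `f₁, f₂ : H ≃* K` are related when the HNN-extensions of `G` that they define
are isomorphic as abstract groups. -/
def hnnIsoSetoid {G : Type*} [Group G] (H K : Subgroup G) : Setoid (H ≃* K) where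
  r f₁ f₂ := Nonempty (HNNExtension G H K f₁ ≃* HNNExtension G H K f₂)
  iseqv :=
    ⟨fun _ => ⟨MulEquiv.refl _⟩, fun ⟨e⟩ => ⟨e.symm⟩, fun ⟨e⟩ ⟨e'⟩ => ⟨e.trans e'⟩⟩

/-- The isomorphism classes of groups of the form `HNN(G, H, K, f, t)` with `f ∈ Iso(H, K)`. -/
abbrev HNNIsoClasses {G : Type*} [Group G] (H K : Subgroup G) : Type _ :=
  Quotient (hnnIsoSetoid H K)

/-! An HNN-extension acts on its Bass–Serre tree: the vertices are the cosets of the base group, the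
edge stabilizers are conjugate into the finite associated subgroups, and the exponent sum of `t` is
a height that rules out inversions. The tree itself is never built. Only the distances `d(P, xP)`
are used, through the axioms of `IsTreeLength` and the four-point condition derived from them.

An OE-group acting in this way fixes a vertex (`exists_fixed_of_isOEGroup`). Having at most one end
makes functions that are almost invariant under right multiplication almost constant; this bounds an
orbit, and a centre of a bounded orbit is fixed. Hence every isomorphism `θ` of HNN-extensions can
be corrected by an inner automorphism so that it restricts to an automorphism `α` of the base
(`exists_mulEquiv_of_eq_of`).

When `K = H`, such a `θ` sends `t` to an element of length 1 (`length_map_t`): images of reduced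
words containing `t` are at least as long as `θ t`, and `t` is one of these images. Write `θ t = g₀
t^u g₁` and let `β` be the restriction to `H` of `α` followed by conjugation by `g₀⁻¹`. Then `g₁g₀`
normalizes `H` and induces `ψ^(-u) β φ β⁻¹` on it (`exists_eq_of_mulEquiv`). In `Out(H)` this puts
`φ` and `ψ` into one orbit.

Conversely, the three kinds of generating permutations come from the substitutions `t ↦ nt`, an
automorphism of the base, and `t ↦ t⁻¹`. The general case reduces to `K = H` by a substitution `t ↦
gt`. -/

/-! ### Ends of graphs and almost invariant functions on OE-groups -/

open CategoryTheory in
/-- An infinite component of the complement of a finite set of vertices belongs to an end. -/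
theorem SimpleGraph.exists_end_of_infinite_component {V : Type*} (Γ : SimpleGraph V)
    [Γ.LocallyFinite] (hΓ : Γ.Preconnected) (K : Finset V) (C : Γ.ComponentCompl K)
    (hC : C.supp.Infinite) : ∃ e ∈ Γ.end, e (Opposite.op K) = C := by
  have : Fact Γ.Preconnected := ⟨hΓ⟩
  have : ∀ j, Finite (Γ.componentComplFunctor.obj j) := fun j => Γ.componentCompl_finite j.unop
  have hinf : Infinite V := Set.infinite_univ_iff.1 (hC.mono (Set.subset_univ _))
  have : ∀ j, Nonempty (Γ.componentComplFunctor.obj j) := fun j =>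
    Γ.componentCompl_nonempty_of_infinite j.unop
  -- The sets of components are finite, so the eventual ranges form a surjective inverse system of
  -- nonempty finite sets; any point of an eventual range lifts to a section.
  have hML : Γ.componentComplFunctor.IsMittagLeffler :=
    Functor.isMittagLeffler_of_exists_finite_range _ fun j => ⟨j, 𝟙 j, Set.toFinite _⟩
  have hmem : C ∈ Γ.componentComplFunctor.eventualRange (Opposite.op K) :=
    (Γ.infinite_iff_in_eventualRange (K := Opposite.op K) C).1 hC
  have : ∀ j, Nonempty (Γ.componentComplFunctor.toEventualRanges.obj j) := fun j =>
    Functor.toEventualRanges_nonempty _ hML j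
  have : ∀ j, Finite (Γ.componentComplFunctor.toEventualRanges.obj j) := fun j =>
    inferInstanceAs (Finite (Γ.componentComplFunctor.eventualRange j))
  obtain ⟨s, hs⟩ := Functor.eval_section_surjective_of_surjective
    (F := Γ.componentComplFunctor.toEventualRanges)
    (fun i j f => Functor.surjective_toEventualRanges _ hML f) (Opposite.op K) ⟨C, hmem⟩
  refine ⟨(Γ.componentComplFunctor.toEventualRangesSectionsEquiv s).1,
    (Γ.componentComplFunctor.toEventualRangesSectionsEquiv s).2, ?_⟩
  exact congrArg Subtype.val hs

/-- In a locally finite connected graph with at most one end, a function that changes along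
finitely many edges only is constant outside a finite set. -/
theorem SimpleGraph.exists_finite_ne_of_finite_coboundary {V X : Type*} [Nonempty X]
    (Γ : SimpleGraph V)
    [Γ.LocallyFinite] (hΓ : Γ.Preconnected) (hend : Γ.end.Subsingleton) (f : V → X)
    (hf : {v | ∃ w, Γ.Adj v w ∧ f v ≠ f w}.Finite) : ∃ c, {v | f v ≠ c}.Finite := by
  classical
  have : Fact Γ.Preconnected := ⟨hΓ⟩
  -- Both ends of every edge along which `f` changes lie in `K`, so `f` is constant on each
  -- component of the complement; two infinite components would give two ends.
  let K : Finset V := hf.toFinset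
  have hconst : ∀ C : Γ.ComponentCompl K, ∃ c, ∀ v ∈ C, f v = c := by
    intro C
    let F : Γ.ComponentCompl K → X := SimpleGraph.ComponentCompl.lift (fun v _ => f v) (by
      intro v w hv _ hvw
      by_contra hne
      exact hv (by simpa [K] using ⟨w, hvw, hne⟩))
    refine ⟨F C, ?_⟩
    rintro v ⟨hv, rfl⟩
    rfl
  choose g hg using hconst
  have huniq : ∀ C D : Γ.ComponentCompl K, C.supp.Infinite → D.supp.Infinite → C = D := by
    intro C D hC hD
    obtain ⟨e, he, rfl⟩ := Γ.exists_end_of_infinite_component hΓ K C hC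
    obtain ⟨e', he', rfl⟩ := Γ.exists_end_of_infinite_component hΓ K D hD
    rw [hend he he']
  have key : ∃ c, ∀ C : Γ.ComponentCompl K, C.supp.Infinite → g C = c := by
    by_cases h : ∃ C : Γ.ComponentCompl K, C.supp.Infinite
    · obtain ⟨C, hC⟩ := h
      exact ⟨g C, fun D hD => by rw [huniq C D hC hD]⟩
    · exact ⟨Classical.arbitrary X, fun C hC => (h ⟨C, hC⟩).elim⟩
  obtain ⟨c, hc⟩ := key
  refine ⟨c, ?_⟩
  have hfin : ((K : Set V) ∪ ⋃ C ∈ {C : Γ.ComponentCompl K | C.supp.Finite}, C.supp).Finite :=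
    K.finite_toSet.union ((Set.toFinite _).biUnion fun C hC => hC)
  refine hfin.subset fun v hv => ?_
  by_cases hvK : v ∈ (K : Set V)
  · exact Or.inl hvK
  · refine Or.inr ?_
    have hvC := Γ.componentComplMk_mem hvK
    refine Set.mem_biUnion (x := Γ.componentComplMk hvK) ?_ hvC
    by_contra hinf
    exact hv ((hg _ v hvC).trans (hc _ hinf))

theorem SimpleGraph.mulCayley_preconnected {G : Type*} [Group G] {S : Set G}
    (hS : Subgroup.closure S = ⊤) : (SimpleGraph.mulCayley S).Preconnected := by
  have h : ∀ g x : G, (SimpleGraph.mulCayley S).Reachable x (x * g) := by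
    intro g
    have hg : g ∈ Subgroup.closure S := hS ▸ Subgroup.mem_top g
    induction hg using Subgroup.closure_induction with
    | mem s hs =>
      intro x
      by_cases h1 : x = x * s
      · rw [← h1]
      · exact SimpleGraph.Adj.reachable ((SimpleGraph.mulCayley_adj' S _ _).2
          ⟨h1, s, hs, Or.inl rfl⟩)
    | one => intro x; rw [mul_one]
    | mul a b _ _ ha hb => intro x; rw [← mul_assoc]; exact (ha x).trans (hb _)
    | inv a _ ha => intro x; simpa using (ha (x * a⁻¹)).symm
  intro x y
  simpa using h (x⁻¹ * y) x

/-- A function on an OE-group that almost commutes with the right multiplications is constant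
outside a finite set. -/
theorem IsOEGroup.exists_finite_ne {G X : Type*} [Group G] [Nonempty X] (hG : IsOEGroup G)
    (f : G → X) (hf : ∀ s, {z | f (z * s) ≠ f z}.Finite) : ∃ c, {z | f z ≠ c}.Finite := by
  classical
  obtain ⟨S, hS, hend⟩ := hG.exists_ends_lt_two
  have hnb : ∀ x : G, ((SimpleGraph.mulCayley (S : Set G)).neighborSet x).Finite := by
    intro x
    refine ((S.finite_toSet.image (x * ·)).union (S.finite_toSet.image (x * ·⁻¹))).subset ?_
    intro y hy
    obtain ⟨-, s, hs, h | h⟩ := (SimpleGraph.mulCayley_adj' _ _ _).1 hy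
    · exact Or.inl ⟨s, hs, h⟩
    · exact Or.inr ⟨s, hs, by simp [h]⟩
  have : (SimpleGraph.mulCayley (S : Set G)).LocallyFinite := fun x => (hnb x).fintype
  refine SimpleGraph.exists_finite_ne_of_finite_coboundary _
    (SimpleGraph.mulCayley_preconnected hS) ?_ f ?_
  · rw [← Set.encard_le_one_iff_subsingleton]
    exact Order.le_of_lt_add_one (by simpa [one_add_one_eq_two] using hend)
  · refine (S.finite_toSet.biUnion fun s _ => (hf s).union (hf s⁻¹)).subset ?_
    rintro v ⟨w, hvw, hne⟩
    obtain ⟨-, s, hs, h | h⟩ := (SimpleGraph.mulCayley_adj' _ _ _).1 hvw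
    · exact Set.mem_biUnion hs (Or.inl (by rw [Set.mem_ofPred_eq, h]; exact hne.symm))
    · refine Set.mem_biUnion hs (Or.inr ?_)
      rw [Set.mem_ofPred_eq, h, mul_inv_cancel_right, ← h]
      exact hne.symm

/-! ### Trees described by length functions -/

/-- `ℓ` is the length function `x ↦ d(P, xP)` of an action of `Γ` on a tree with vertex set
`Γ ⧸ P`. -/
structure IsTreeLength {Γ : Type*} [Group Γ] (P : Subgroup Γ) (ℓ : Γ → ℕ) : Prop where
  eq_zero_iff : ∀ x, ℓ x = 0 ↔ x ∈ P
  inv_eq : ∀ x, ℓ x⁻¹ = ℓ x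
  mul_le : ∀ x y, ℓ (x * y) ≤ ℓ x + ℓ y
  step : ∀ b y, ℓ b = 1 → ℓ (b⁻¹ * y) = ℓ y + 1 ∨ ℓ (b⁻¹ * y) + 1 = ℓ y
  exists_step : ∀ y, 0 < ℓ y → ∃ b, ℓ b = 1 ∧ ℓ (b⁻¹ * y) + 1 = ℓ y
  unique_step : ∀ b b' y, ℓ b = 1 → ℓ b' = 1 → ℓ (b⁻¹ * y) + 1 = ℓ y →
    ℓ (b'⁻¹ * y) + 1 = ℓ y → b⁻¹ * b' ∈ P

namespace IsTreeLength

variable {Γ : Type*} [Group Γ] {P : Subgroup Γ} {ℓ : Γ → ℕ}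

theorem mul_right (h : IsTreeLength P ℓ) (x : Γ) {p : Γ} (hp : p ∈ P) : ℓ (x * p) = ℓ x := by
  have h0 := (h.eq_zero_iff p).2 hp
  have h1 := h.mul_le x p
  have h2 := h.mul_le (x * p) p⁻¹
  rw [mul_inv_cancel_right, h.inv_eq] at h2
  omega

theorem mul_left (h : IsTreeLength P ℓ) {p : Γ} (hp : p ∈ P) (x : Γ) : ℓ (p * x) = ℓ x := by
  rw [← h.inv_eq, mul_inv_rev, h.mul_right _ (P.inv_mem hp), h.inv_eq]

theorem comm (h : IsTreeLength P ℓ) (x y : Γ) : ℓ (x⁻¹ * y) = ℓ (y⁻¹ * x) := by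
  rw [← h.inv_eq, mul_inv_rev, inv_inv]

/-- Induction along the geodesics of the tree. -/
theorem induction_step (h : IsTreeLength P ℓ) {motive : Γ → Prop}
    (base : ∀ p ∈ P, motive p) (step : ∀ b x, ℓ b = 1 → ℓ (b * x) = ℓ x + 1 → motive x →
      motive (b * x)) (x : Γ) : motive x := by
  induction hn : ℓ x generalizing x with
  | zero => exact base x ((h.eq_zero_iff x).1 hn)
  | succ n ih =>
    obtain ⟨b, hb, hbx⟩ := h.exists_step x (by omega)
    have := step b (b⁻¹ * x) hb (by rw [mul_inv_cancel_left]; omega) (ih _ (by omega))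
    rwa [mul_inv_cancel_left] at this

/-- Two geodesics from the base vertex with different first edges. -/
theorem add_of_step (h : IsTreeLength P ℓ) {b x y : Γ} (hb : ℓ b = 1)
    (hx : ℓ (b⁻¹ * x) + 1 = ℓ x) (hy : ℓ (b⁻¹ * y) = ℓ y + 1) : ℓ (x⁻¹ * y) = ℓ x + ℓ y := by
  induction hn : ℓ (b⁻¹ * x) generalizing b x y with
  | zero =>
    have hm := (h.eq_zero_iff _).1 hn
    have : x⁻¹ * y = (b⁻¹ * x)⁻¹ * (b⁻¹ * y) := by group
    rw [this, h.mul_left (P.inv_mem hm)]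
    omega
  | succ n ih =>
    obtain ⟨b', hb', hx'⟩ := h.exists_step (b⁻¹ * x) (by omega)
    have hb1 : ℓ b⁻¹ = 1 := by rw [h.inv_eq, hb]
    -- Seen from `b`, the geodesic to `y` goes back through the old base vertex. By uniqueness of
    -- the first step, `b'` could only lie on it by being that vertex, but `b'` leads on towards
    -- `x`.
    have hy' : ℓ (b'⁻¹ * (b⁻¹ * y)) = ℓ (b⁻¹ * y) + 1 := by
      rcases h.step b' (b⁻¹ * y) hb' with h1 | h1
      · exact h1
      · have hu := h.unique_step b' b⁻¹ (b⁻¹ * y) hb' hb1 h1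
          (by rw [inv_inv, mul_inv_cancel_left]; omega)
        have hl := h.mul_left (P.inv_mem hu) (b'⁻¹ * (b⁻¹ * x))
        have he : (b'⁻¹ * b⁻¹)⁻¹ * (b'⁻¹ * (b⁻¹ * x)) = x := by group
        rw [he] at hl
        omega
    have := ih hb' hx' hy' (by omega)
    have he : (b⁻¹ * x)⁻¹ * (b⁻¹ * y) = x⁻¹ * y := by group
    rw [he] at this
    omega

/-- The four-point condition, with one of the points at the base vertex. -/
theorem four_point_base (h : IsTreeLength P ℓ) (x y z : Γ) :
    ℓ (x⁻¹ * y) + ℓ z ≤ max (ℓ (x⁻¹ * z) + ℓ y) (ℓ (y⁻¹ * z) + ℓ x) := by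
  induction hn : ℓ z generalizing x y z with
  | zero =>
    have hz := (h.eq_zero_iff _).1 hn
    have h1 := h.mul_le x⁻¹ y
    rw [h.mul_right _ hz, h.mul_right _ hz]
    simp only [h.inv_eq] at *
    omega
  | succ n ih =>
    obtain ⟨b, hb, hz⟩ := h.exists_step z (by omega)
    have h1 := h.mul_le x⁻¹ y
    rw [h.inv_eq] at h1
    -- If the geodesic to `x` or `y` does not start with `b`, distances to `z` add up. Otherwise the
    -- base vertex moves to `b`, which lowers the lengths of `x`, `y`, `z` by one and keeps their
    -- mutual distances.
    rcases h.step b x hb with hx | hx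
    · have := h.add_of_step hb hz hx
      rw [h.comm] at this
      omega
    rcases h.step b y hb with hy | hy
    · have := h.add_of_step hb hz hy
      rw [h.comm] at this
      omega
    have := ih (b⁻¹ * x) (b⁻¹ * y) (b⁻¹ * z) (by omega)
    have e : ∀ u v : Γ, (b⁻¹ * u)⁻¹ * (b⁻¹ * v) = u⁻¹ * v := fun u v => by group
    simp only [e] at this
    omega

theorem four_point (h : IsTreeLength P ℓ) (x y z w : Γ) :
    ℓ (x⁻¹ * y) + ℓ (w⁻¹ * z) ≤
      max (ℓ (x⁻¹ * z) + ℓ (w⁻¹ * y)) (ℓ (y⁻¹ * z) + ℓ (w⁻¹ * x)) := by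
  have := h.four_point_base (w⁻¹ * x) (w⁻¹ * y) (w⁻¹ * z)
  have e : ∀ u v : Γ, (w⁻¹ * u)⁻¹ * (w⁻¹ * v) = u⁻¹ * v := fun u v => by group
  simpa only [e] using this

theorem mul_mod_two (h : IsTreeLength P ℓ) (x y : Γ) : ℓ (x * y) % 2 = (ℓ x + ℓ y) % 2 := by
  induction x using h.induction_step generalizing y with
  | base p hp => rw [h.mul_left hp, (h.eq_zero_iff p).2 hp, zero_add]
  | step b x hb hbx ih =>
    have := h.step b⁻¹ (x * y) (by rw [h.inv_eq, hb])
    rw [inv_inv] at this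
    rw [mul_assoc, hbx]
    have := ih y
    omega

theorem exists_adjacent (h : IsTreeLength P ℓ) (x y : Γ) (hxy : 0 < ℓ (x⁻¹ * y)) :
    ∃ z, ℓ (x⁻¹ * z) = 1 ∧ ℓ (z⁻¹ * y) + 1 = ℓ (x⁻¹ * y) := by
  obtain ⟨b, hb, h1⟩ := h.exists_step _ hxy
  refine ⟨x * b, by rwa [inv_mul_cancel_left], ?_⟩
  rwa [mul_inv_rev, mul_assoc]

/-- If `b` is the first vertex on the geodesic to `w` and `g` fixes the base vertex but not `b`,
then the geodesics to `w` and `gw` have only the base vertex in common. -/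
theorem two_mul_of_step (h : IsTreeLength P ℓ) {b w g : Γ} (hb : ℓ b = 1)
    (hw : ℓ (b⁻¹ * w) + 1 = ℓ w) (hg : g ∈ P) (hgb : b⁻¹ * g * b ∉ P) :
    ℓ (w⁻¹ * g * w) = 2 * ℓ w := by
  have hgw : ℓ (g * w) = ℓ w := h.mul_left hg w
  have h1 : ℓ (b⁻¹ * (g * w)) = ℓ (g * w) + 1 := by
    rcases h.step b (g * w) hb with h1 | h1
    · exact h1
    · refine absurd (h.unique_step b (g * b) (g * w) hb (by rw [h.mul_left hg, hb]) h1 ?_) ?_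
      · rw [show (g * b)⁻¹ * (g * w) = b⁻¹ * w by group]; omega
      · rwa [← mul_assoc]
  have := h.add_of_step hb hw h1
  rw [← mul_assoc] at this
  omega

/-- A conjugate of `P` that contains `P` is `P`, if the stabilizers of edges are finite. -/
theorem conj_mem_of_conj_le (h : IsTreeLength P ℓ)
    (hfin : ∀ b, ℓ b = 1 → {p | p ∈ P ∧ b⁻¹ * p * b ∈ P}.Finite) {z : Γ}
    (hz : ∀ p ∈ P, z⁻¹ * p * z ∈ P) {p : Γ} (hp : p ∈ P) : z * p * z⁻¹ ∈ P := by
  rcases Nat.eq_zero_or_pos (ℓ z) with h0 | h0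
  · have := (h.eq_zero_iff z).1 h0
    exact P.mul_mem (P.mul_mem this hp) (P.inv_mem this)
  · obtain ⟨b, hb, hbz⟩ := h.exists_step z h0
    -- `P` fixes the base vertex and the vertex of `z`, hence the first edge between them. So `P` is
    -- finite, and the injective conjugation of `P` into itself is onto.
    have hPb : ∀ q ∈ P, b⁻¹ * q * b ∈ P := by
      intro q hq
      by_contra hne
      have h1 := h.two_mul_of_step hb hbz hq hne
      have h2 := (h.eq_zero_iff _).2 (hz q hq)
      omega
    have hP : (P : Set Γ).Finite := (hfin b hb).subset fun q hq => ⟨hq, hPb q hq⟩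
    have : Finite P := hP
    let f : P → P := fun q => ⟨z⁻¹ * q * z, hz q q.2⟩
    have hf : Function.Injective f := fun q r hqr => by
      have := congrArg Subtype.val hqr
      simpa [f] using this
    obtain ⟨q, hq⟩ := Finite.surjective_of_injective hf ⟨p, hp⟩
    have hq' : z⁻¹ * q * z = p := congrArg Subtype.val hq
    rw [← hq', show z * (z⁻¹ * q * z) * z⁻¹ = (q : Γ) by group]
    exact q.2

/-! ### Heights, hyperbolic elements and fixed vertices -/

section Height

variable {τ : Γ →* Multiplicative ℤ}

/-- `τ` is the height function of an orientation of the edges of the tree. -/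
structure IsHeight (P : Subgroup Γ) (ℓ : Γ → ℕ) (τ : Γ →* Multiplicative ℤ) : Prop where
  base : ∀ p ∈ P, τ p = 1
  step : ∀ b, ℓ b = 1 → (τ b).toAdd = 1 ∨ (τ b).toAdd = -1

theorem abs_height_le (h : IsTreeLength P ℓ) (hτ : IsHeight P ℓ τ) (x : Γ) :
    |(τ x).toAdd| ≤ ℓ x := by
  induction x using h.induction_step with
  | base p hp => simp [hτ.base p hp]
  | step b x hb hbx ih =>
    rw [map_mul, toAdd_mul, hbx]
    rcases hτ.step b hb with h1 | h1 <;> rw [h1] <;> push_cast <;> rw [abs_le] at * <;> omega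

theorem length_mod_two (h : IsTreeLength P ℓ) (hτ : IsHeight P ℓ τ) (x : Γ) :
    (ℓ x : ℤ) % 2 = (τ x).toAdd % 2 := by
  induction x using h.induction_step with
  | base p hp => simp [hτ.base p hp, (h.eq_zero_iff p).2 hp]
  | step b x hb hbx ih =>
    rw [map_mul, toAdd_mul, hbx]
    push_cast
    rcases hτ.step b hb with h1 | h1 <;> omega

/-- The height of `x ^ k` is `k` times that of `x`, and lengths bound heights. -/
theorem height_eq_one_of_bounded (h : IsTreeLength P ℓ) (hτ : IsHeight P ℓ τ) {x : Γ} {N : ℕ}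
    (hN : ∀ k : ℕ, ℓ (x ^ k) ≤ N) : τ x = 1 := by
  by_contra hne
  have h1 := (h.abs_height_le hτ (x ^ (N + 1))).trans (Int.ofNat_le.2 (hN (N + 1)))
  rw [map_pow, toAdd_pow, nsmul_eq_mul, abs_mul] at h1
  have h2 : 1 ≤ |(τ x).toAdd| := Int.one_le_abs fun h0 => hne (toAdd_eq_zero.1 h0)
  push_cast at h1
  rw [abs_of_nonneg (by positivity)] at h1
  nlinarith

/-- An element that changes heights is hyperbolic. -/
theorem lt_length_mul_self (h : IsTreeLength P ℓ) (hτ : IsHeight P ℓ τ) {w : Γ}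
    (hw : τ w ≠ 1) : ℓ w < ℓ (w * w) := by
  by_contra hle
  push Not at hle
  refine hw (h.height_eq_one_of_bounded hτ (N := ℓ w) ?_)
  have : ∀ k : ℕ, ℓ (w ^ k) ≤ ℓ w ∧ ℓ (w ^ (k + 1)) ≤ ℓ w := by
    intro k
    induction k with
    | zero =>
      rw [pow_zero, (h.eq_zero_iff 1).2 P.one_mem, zero_add, pow_one]
      exact ⟨Nat.zero_le _, le_rfl⟩
    | succ k ih =>
      refine ⟨ih.2, ?_⟩
      -- The condition reads `ℓ(w^(k+2)) + ℓ(w) ≤ max (ℓ(w²) + ℓ(w^(k+1))) (ℓ(w^k) + ℓ(w))`, and the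
      -- right side is at most `2ℓ(w)`.
      have h1 := h.four_point 1 (w ^ (k + 2)) (w * w) w
      have e1 : (w ^ (k + 2))⁻¹ * (w * w) = (w ^ k)⁻¹ := by
        rw [inv_mul_eq_iff_eq_mul, eq_mul_inv_iff_mul_eq, ← pow_two, ← pow_add, add_comm]
      have e2 : w⁻¹ * w ^ (k + 2) = w ^ (k + 1) := by
        rw [inv_mul_eq_iff_eq_mul, ← pow_succ']
      rw [e1, e2] at h1
      simp only [inv_one, one_mul, mul_one, inv_mul_cancel_left, h.inv_eq] at h1
      change ℓ (w ^ (k + 2)) ≤ ℓ w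
      omega
  exact fun k => (this k).1

/-- A group of automorphisms with a bounded orbit that preserves an orientation
fixes a vertex. -/
theorem exists_fixed_of_bounded (h : IsTreeLength P ℓ) (hτ : IsHeight P ℓ τ) {L : Type*} [Group L]
    (j : L →* Γ) {N : ℕ} (hN : ∀ x, ℓ (j x) ≤ N) : ∃ u, ∀ x, u⁻¹ * j x * u ∈ P := by
  have hbdd : ∀ u, BddAbove (Set.range fun x => ℓ (u⁻¹ * j x)) := by
    intro u
    refine ⟨ℓ u + N, ?_⟩
    rintro _ ⟨x, rfl⟩
    have h1 := h.mul_le u⁻¹ (j x)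
    have h2 := hN x
    rw [h.inv_eq] at h1
    dsimp only
    omega
  -- The radius of the orbit as seen from `u`; a vertex minimizing it is a centre.
  let F : Γ → ℕ := fun u => ⨆ x, ℓ (u⁻¹ * j x)
  have hF : ∀ u x, ℓ (u⁻¹ * j x) ≤ F u := fun u x => le_ciSup (hbdd u) x
  obtain ⟨u, hu⟩ : ∃ u, ∀ v, F u ≤ F v := ⟨Function.argmin F, fun v => Function.argmin_le F v⟩
  have hFinv : ∀ y, F (j y * u) = F u := by
    intro y
    have : ∀ x, ℓ ((j y * u)⁻¹ * j x) = ℓ (u⁻¹ * j (y⁻¹ * x)) := by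
      intro x
      rw [map_mul, map_inv, mul_inv_rev, mul_assoc]
    change (⨆ x, ℓ ((j y * u)⁻¹ * j x)) = ⨆ x, ℓ (u⁻¹ * j x)
    simp only [this]
    exact (Equiv.mulLeft y⁻¹).iSup_comp (g := fun x => ℓ (u⁻¹ * j x))
  refine ⟨u, fun y => ?_⟩
  rw [mul_assoc]
  rw [← h.eq_zero_iff]
  by_contra hne
  have hτ1 : τ (j y) = 1 :=
    h.height_eq_one_of_bounded hτ (N := N) fun k => by rw [← map_pow]; exact hN _
  -- Heights are preserved, so a moved centre is moved by an even distance, at least 2. The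
  -- neighbour `b` of `u` towards its image then has a smaller radius, by the four-point condition.
  have hpar := h.length_mod_two hτ (u⁻¹ * (j y * u))
  rw [τ.map_mul, τ.map_mul, hτ1, one_mul, τ.map_inv, inv_mul_cancel, toAdd_one] at hpar
  obtain ⟨b, hb1, hb2⟩ := h.exists_adjacent u (j y * u) (by omega)
  have hlt : F b + 1 ≤ F u := by
    have : F b ≤ F u - 1 ∧ 1 ≤ F u := by
      have key : ∀ x, ℓ (b⁻¹ * j x) + 1 ≤ F u := by
        intro x
        have h1 := h.four_point b (j x) (j y * u) u
        have h2 := hF u x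
        have h3 := hF (j y * u) x
        rw [hFinv] at h3
        rw [hb1, h.comm (j x)] at h1
        omega
      exact ⟨ciSup_le fun x => by have := key x; omega, by have := key 1; omega⟩
    omega
  have := hu b
  omega

end Height

/-! ### OE-groups acting on trees -/

section OneEnded

/-- The overlap of the geodesics from `p` to `q` and from `r` to `r'`, counted with
orientation. -/
def overlap (ℓ : Γ → ℕ) (p q r r' : Γ) : ℤ :=
  ℓ (q⁻¹ * r) - ℓ (q⁻¹ * r') - ℓ (p⁻¹ * r) + ℓ (p⁻¹ * r')

/-- By parity, the distances from `p` to the ends of the second edge differ by exactly 1, and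
likewise from `q`. If these differences disagree, the four-point condition forces the two edges to
coincide. -/
theorem mem_of_overlap_ne_zero (h : IsTreeLength P ℓ) {p q r r' : Γ} (hpq : ℓ (p⁻¹ * q) = 1)
    (hr : ℓ (r⁻¹ * r') = 1) (hne : overlap ℓ p q r r' ≠ 0) :
    (p⁻¹ * r ∈ P ∧ q⁻¹ * r' ∈ P) ∨ (q⁻¹ * r ∈ P ∧ p⁻¹ * r' ∈ P) := by
  unfold overlap at hne
  simp only [← h.eq_zero_iff]
  have par : ∀ x y z : Γ, (ℓ (x⁻¹ * y) + ℓ (y⁻¹ * z)) % 2 = ℓ (x⁻¹ * z) % 2 := by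
    intro x y z
    rw [← h.mul_mod_two, mul_assoc, mul_inv_cancel_left]
  have p1 := par q r r'
  have p2 := par p r r'
  have h1 := h.four_point q r r' p
  have h2 := h.four_point q r' r p
  rw [h.comm r' r] at h2
  omega

/-- The overlap is additive under concatenation in each of the two paths, so single edges suffice.
The `y` carrying one given edge to another lie in a coset of an edge stabilizer, which is finite. -/
theorem finite_overlap_ne_zero (h : IsTreeLength P ℓ)
    (hfin : ∀ b, ℓ b = 1 → {p | p ∈ P ∧ b⁻¹ * p * b ∈ P}.Finite) {L : Type*} [Group L]
    {j : L →* Γ} (hj : Function.Injective j) (p q r r' : Γ) :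
    {y | overlap ℓ p q (j y * r) (j y * r') ≠ 0}.Finite := by
  have edge : ∀ p q r r', ℓ (p⁻¹ * q) = 1 → ℓ (r⁻¹ * r') = 1 →
      {y | p⁻¹ * (j y * r) ∈ P ∧ q⁻¹ * (j y * r') ∈ P}.Finite := by
    intro p q r r' _ hr
    rcases Set.eq_empty_or_nonempty {y | p⁻¹ * (j y * r) ∈ P ∧ q⁻¹ * (j y * r') ∈ P} with
      h0 | ⟨y₀, hy₀, hy₀'⟩
    · rw [h0]; exact Set.finite_empty
    · refine Set.Finite.of_finite_image (f := fun y => r⁻¹ * j (y₀⁻¹ * y) * r)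
        ((hfin _ hr).subset ?_) ?_
      · rintro _ ⟨y, ⟨hy, hy'⟩, rfl⟩
        refine ⟨?_, ?_⟩
        · have := P.mul_mem (P.inv_mem hy₀) hy
          convert this using 1
          simp only [map_mul, map_inv]
          group
        · have := P.mul_mem (P.inv_mem hy₀') hy'
          convert this using 1
          simp only [map_mul, map_inv]
          group
      · intro y _ z _ hyz
        exact hj (by simpa using hyz)
  have chain : ∀ R : Γ → Γ → Prop, (∀ x y z, R x y → R y z → R x z) →
      (∀ x y, x⁻¹ * y ∈ P → R x y) → (∀ x y, ℓ (x⁻¹ * y) = 1 → R x y) → ∀ x y, R x y := by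
    intro R htrans h0 h1
    have : ∀ z x, R x (x * z) := by
      intro z
      induction z using h.induction_step with
      | base p hp => exact fun x => h0 _ _ (by rwa [inv_mul_cancel_left])
      | step b z hb _ ih =>
        intro x
        rw [← mul_assoc]
        exact htrans _ _ _ (h1 x (x * b) (by rwa [inv_mul_cancel_left])) (ih _)
    intro x y
    simpa using this (x⁻¹ * y) x
  have eqP : ∀ x y z, x⁻¹ * y ∈ P → ℓ (x⁻¹ * z) = ℓ (y⁻¹ * z) := by
    intro x y z hxy
    rw [← h.mul_left hxy (y⁻¹ * z), mul_assoc, mul_inv_cancel_left]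
  have eqP' : ∀ x y z, x⁻¹ * y ∈ P → ℓ (z⁻¹ * x) = ℓ (z⁻¹ * y) := by
    intro x y z hxy
    rw [h.comm, eqP x y z hxy, h.comm]
  have step1 : ∀ r r', ℓ (r⁻¹ * r') = 1 → ∀ p q,
      {y | overlap ℓ p q (j y * r) (j y * r') ≠ 0}.Finite := by
    intro r r' hr
    refine chain _ (fun p q s h1 h2 => (h1.union h2).subset ?_) (fun p q hpq => ?_)
      (fun p q hpq => ?_)
    · intro y hy
      by_contra hn
      simp only [Set.mem_union, Set.mem_ofPred_eq, not_or, not_not] at hn hy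
      apply hy
      unfold overlap at *
      omega
    · convert Set.finite_empty
      ext y
      simp [overlap, eqP p q _ hpq]
    · refine ((edge p q r r' hpq hr).union (edge q p r r' (by rw [h.comm, hpq]) hr)).subset ?_
      intro y hy
      refine h.mem_of_overlap_ne_zero hpq ?_ hy
      rwa [show (j y * r)⁻¹ * (j y * r') = r⁻¹ * r' by group]
  revert r r'
  refine chain _ (fun r s t h1 h2 => (h1.union h2).subset ?_) (fun r s hrs => ?_)
      (fun r s hrs => step1 r s hrs p q)
  · intro y hy
    by_contra hn
    simp only [Set.mem_union, Set.mem_ofPred_eq, not_or, not_not] at hn hy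
    apply hy
    unfold overlap at *
    omega
  · convert Set.finite_empty
    ext y
    have h1 := fun z => eqP' (j y * r) (j y * s) z
      (by rwa [show (j y * r)⁻¹ * (j y * s) = r⁻¹ * s by group])
    simp [overlap, h1]

/-- An infinite OE-group has bounded orbits in a tree with finite edge stabilizers. -/
theorem exists_bound_of_isOEGroup (h : IsTreeLength P ℓ)
    (hfin : ∀ b, ℓ b = 1 → {p | p ∈ P ∧ b⁻¹ * p * b ∈ P}.Finite) {L : Type*} [Group L]
    (hL : IsOEGroup L) [Infinite L] {j : L →* Γ} (hj : Function.Injective j) :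
    ∃ N, ∀ x, ℓ (j x) ≤ N := by
  -- A Busemann-type difference of the distances from the vertex of `z` to the base vertex and to
  -- the vertex of `x`. Changing `z` to `z * s` alters it by an overlap, so it has an almost
  -- constant value `B x`.
  let F : L → L → ℤ := fun x z => ℓ (j z) - ℓ (j (z⁻¹ * x))
  have hF : ∀ x, ∃ c, {z | F x z ≠ c}.Finite := by
    intro x
    refine hL.exists_finite_ne (F x) fun s => ?_
    refine ((h.finite_overlap_ne_zero hfin hj 1 (j s) 1 (j x)).preimage
      inv_injective.injOn).subset ?_
    intro z hz hz0
    apply hz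
    simp only [overlap, mul_one, inv_one, one_mul, map_inv] at hz0
    simp only [F]
    rw [mul_inv_rev, ← h.inv_eq (j (z * s)), ← h.inv_eq (j z)]
    simp only [map_mul, map_inv, mul_inv_rev, mul_assoc] at hz0 ⊢
    omega
  choose B hB using hF
  have hBmul : ∀ x y, B (x * y) = B x + B y := by
    intro x y
    obtain ⟨z, hz⟩ := ((((hB (x * y)).union (hB x))).union
      ((hB y).preimage (f := (x⁻¹ * ·)) (mul_right_injective _).injOn)).infinite_compl.nonempty
    simp only [Set.mem_compl_iff, Set.mem_union, Set.mem_ofPred_eq, Set.mem_preimage, not_or,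
      not_not, F] at hz
    obtain ⟨⟨h1, h2⟩, h3⟩ := hz
    rw [← h1, ← h2, ← h3]
    rw [← h.inv_eq (j (x⁻¹ * z))]
    simp only [map_mul, map_inv, mul_inv_rev, mul_assoc, inv_inv]
    omega
  have hBone : B 1 = 0 := by
    have := hBmul 1 1
    rw [mul_one] at this
    omega
  have hBpow : ∀ x (k : ℕ), B (x ^ k) = k * B x := by
    intro x k
    induction k with
    | zero => simp [hBone]
    | succ k ih => rw [pow_succ, hBmul, ih]; push_cast; ring
  -- `B` is additive, so it kills torsion. For `x` of infinite order, the values of `F x` at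
  -- `x^(k+1)` and `x^(-k)` are opposite, and for some `k` both equal `B x`.
  have hBzero : ∀ x, B x = 0 := by
    intro x
    by_cases hx : IsOfFinOrder x
    · obtain ⟨k, hk, hxk⟩ := isOfFinOrder_iff_pow_eq_one.1 hx
      have := hBpow x k
      rw [hxk, hBone] at this
      rcases mul_eq_zero.1 this.symm with h0 | h0
      · exact absurd (Int.natCast_eq_zero.1 h0) hk.ne'
      · exact h0
    · have hinj : Function.Injective (fun k : ℕ => x ^ k) :=
        injective_pow_iff_not_isOfFinOrder.2 hx
      have hinj1 : Function.Injective (fun k : ℕ => x ^ (k + 1)) := fun a b hab =>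
        Nat.succ_injective (hinj hab)
      have hinj2 : Function.Injective (fun k : ℕ => (x ^ k)⁻¹) := inv_injective.comp hinj
      obtain ⟨k, hk⟩ := (((hB x).preimage (f := fun k : ℕ => x ^ (k + 1)) hinj1.injOn).union
        ((hB x).preimage (f := fun k : ℕ => (x ^ k)⁻¹) hinj2.injOn)).infinite_compl.nonempty
      simp only [Set.mem_compl_iff, Set.mem_union, Set.mem_ofPred_eq, Set.mem_preimage, not_or,
        not_not, F] at hk
      obtain ⟨h1, h2⟩ := hk
      have e1 : (x ^ (k + 1))⁻¹ * x = (x ^ k)⁻¹ := by rw [pow_succ']; group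
      rw [e1, map_inv, h.inv_eq] at h1
      rw [inv_inv, ← pow_succ, map_inv, h.inv_eq] at h2
      omega
  -- Since `B s = 0`, `ℓ (j (z * s)) = ℓ (j z)` for almost all `z`; the length itself is therefore
  -- almost constant.
  obtain ⟨c, hc⟩ := hL.exists_finite_ne (fun z => ℓ (j z)) fun s => by
    refine ((hB s).preimage inv_injective.injOn).subset ?_
    intro z hz hz0
    apply hz
    rw [hBzero] at hz0
    simp only [F, inv_inv, map_inv, h.inv_eq] at hz0
    omega
  obtain ⟨N, hN⟩ := (hc.image fun z => ℓ (j z)).bddAbove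
  refine ⟨max N c, fun x => ?_⟩
  by_cases hx : ℓ (j x) = c
  · exact hx ▸ le_max_right _ _
  · exact (hN ⟨x, hx, rfl⟩).trans (le_max_left _ _)

/-- An OE-group that acts on a tree with finite edge stabilizers, preserving an orientation,
fixes a vertex. -/
theorem exists_fixed_of_isOEGroup (h : IsTreeLength P ℓ) {τ : Γ →* Multiplicative ℤ}
    (hτ : IsHeight P ℓ τ) (hfin : ∀ b, ℓ b = 1 → {p | p ∈ P ∧ b⁻¹ * p * b ∈ P}.Finite)
    {L : Type*} [Group L] (hL : IsOEGroup L) {j : L →* Γ} (hj : Function.Injective j) :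
    ∃ u, ∀ x, u⁻¹ * j x * u ∈ P := by
  obtain ⟨N, hN⟩ : ∃ N, ∀ x, ℓ (j x) ≤ N := by
    rcases finite_or_infinite L with hfinL | hinfL
    · obtain ⟨N, hN⟩ := (Set.finite_range fun x => ℓ (j x)).bddAbove
      exact ⟨N, fun x => hN ⟨x, rfl⟩⟩
    · exact h.exists_bound_of_isOEGroup hfin hL hj
  exact h.exists_fixed_of_bounded hτ j hN

end OneEnded

end IsTreeLength

/-! ### The length function of an HNN-extension -/

namespace HNNExtension

open NormalWord

variable {G : Type*} [Group G] {A B : Subgroup G} {φ : A ≃* B}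

/-- The number of occurrences of the stable letter in the normal form of an element. -/
noncomputable def length (x : HNNExtension G A B φ) : ℕ :=
  (x • (empty : NormalWord (TransversalPair.nonempty G A B).some)).toList.length

theorem length_of_mul (g : G) (x : HNNExtension G A B φ) : length (of g * x) = length x := by
  rw [length, mul_smul, of_smul_eq_smul, group_smul_toList, length]

theorem length_one : length (1 : HNNExtension G A B φ) = 0 := by
  rw [length, one_smul]; rfl

theorem length_of (g : G) : length (of g : HNNExtension G A B φ) = 0 := by
  rw [← mul_one (of g), length_of_mul, length_one]

theorem length_zpow_t_mul_of_cancels {u : ℤˣ} {x : HNNExtension G A B φ}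
    (hc : Cancels u (x • (empty : NormalWord (TransversalPair.nonempty G A B).some))) :
    length (t ^ (u : ℤ) * x) + 1 = length x := by
  rw [length, length, mul_smul, t_pow_smul_eq_unitsSMul]
  generalize x • (empty : NormalWord (TransversalPair.nonempty G A B).some) = w at *
  rw [unitsSMul, dif_pos hc]
  cases w using consRecOn with
  | ofGroup g => simp [Cancels] at hc
  | cons g u' w h1 h2 => rfl

theorem length_zpow_t_mul_of_not_cancels {u : ℤˣ} {x : HNNExtension G A B φ}
    (hc : ¬ Cancels u (x • (empty : NormalWord (TransversalPair.nonempty G A B).some))) :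
    length (t ^ (u : ℤ) * x) = length x + 1 := by
  rw [length, length, mul_smul, t_pow_smul_eq_unitsSMul, unitsSMul, dif_neg hc]
  rfl

theorem cancels_of_length_lt {u : ℤˣ} {x : HNNExtension G A B φ}
    (h : length (t ^ (u : ℤ) * x) < length x + 1) :
    Cancels u (x • (empty : NormalWord (TransversalPair.nonempty G A B).some)) := by
  by_contra hc
  exact h.ne (length_zpow_t_mul_of_not_cancels hc)

theorem length_zpow_t_mul (u : ℤˣ) (x : HNNExtension G A B φ) :
    length (t ^ (u : ℤ) * x) = length x + 1 ∨ length (t ^ (u : ℤ) * x) + 1 = length x := by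
  by_cases hc : Cancels u (x • (empty : NormalWord (TransversalPair.nonempty G A B).some))
  · exact Or.inr (length_zpow_t_mul_of_cancels hc)
  · exact Or.inl (length_zpow_t_mul_of_not_cancels hc)

theorem length_of_mul_zpow_t (g : G) (u : ℤˣ) :
    length (of g * t ^ (u : ℤ) : HNNExtension G A B φ) = 1 := by
  rw [length_of_mul, ← mul_one (t ^ _), length_zpow_t_mul_of_not_cancels, length_one]
  rw [one_smul]
  simp [Cancels]

theorem length_eq_zero_iff (x : HNNExtension G A B φ) : length x = 0 ↔ x ∈ (of : G →* _).range := by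
  constructor
  · intro h
    rw [length, List.length_eq_zero_iff] at h
    refine ⟨(x • (empty : NormalWord (TransversalPair.nonempty G A B).some)).head, ?_⟩
    have h1 : (x • (empty : NormalWord (TransversalPair.nonempty G A B).some)).prod φ = x := by
      rw [prod_smul, prod_empty, mul_one]
    conv_rhs => rw [← h1]
    rw [ReducedWord.prod, h]
    simp
  · rintro ⟨g, rfl⟩
    exact length_of g

theorem exists_eq_mul_zpow_t_mul (x : HNNExtension G A B φ) (hx : 0 < length x) :
    ∃ (g : G) (u : ℤˣ) (y : HNNExtension G A B φ), x = of g * t ^ (u : ℤ) * y ∧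
      length y + 1 = length x := by
  have h1 : (x • (empty : NormalWord (TransversalPair.nonempty G A B).some)).prod φ = x := by
    rw [prod_smul, prod_empty, mul_one]
  rw [length] at hx
  rw [length]
  generalize x • (empty : NormalWord (TransversalPair.nonempty G A B).some) = w at *
  cases w using consRecOn with
  | ofGroup g => simp at hx
  | cons g u w _ _ =>
    refine ⟨g, u, w.prod φ, ?_, ?_⟩
    · rw [← h1, prod_cons, mul_assoc]
    · rw [length, prod_smul_empty]
      simp

theorem exists_of_length_eq_one {b : HNNExtension G A B φ} (hb : length b = 1) :
    ∃ (g : G) (u : ℤˣ) (g' : G), b = of g * t ^ (u : ℤ) * of g' := by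
  obtain ⟨g, u, y, rfl, hy⟩ := exists_eq_mul_zpow_t_mul b (by omega)
  obtain ⟨g', rfl⟩ := (length_eq_zero_iff y).1 (by omega)
  exact ⟨g, u, g', rfl⟩

theorem inv_mul_eq (g g' : G) (u : ℤˣ) (y : HNNExtension G A B φ) :
    (of g * t ^ (u : ℤ) * of g')⁻¹ * y =
      of g'⁻¹ * (t ^ ((-u : ℤˣ) : ℤ) * (of g⁻¹ * y)) := by
  simp [mul_assoc]

theorem length_step (b y : HNNExtension G A B φ) (hb : length b = 1) :
    length (b⁻¹ * y) = length y + 1 ∨ length (b⁻¹ * y) + 1 = length y := by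
  obtain ⟨g, u, g', rfl⟩ := exists_of_length_eq_one hb
  rw [inv_mul_eq, length_of_mul]
  have := length_zpow_t_mul (-u) (of g⁻¹ * y)
  rwa [length_of_mul g⁻¹ y] at this

theorem length_mul_le (x y : HNNExtension G A B φ) : length (x * y) ≤ length x + length y := by
  induction hn : length x generalizing x with
  | zero =>
    obtain ⟨g, rfl⟩ := (length_eq_zero_iff x).1 hn
    rw [length_of_mul, zero_add]
  | succ n ih =>
    obtain ⟨g, u, z, rfl, hz⟩ := exists_eq_mul_zpow_t_mul x (by omega)
    have := ih z (by omega)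
    rw [mul_assoc, mul_assoc, length_of_mul]
    have := length_zpow_t_mul u (z * y)
    omega

theorem length_inv_le (x : HNNExtension G A B φ) : length x⁻¹ ≤ length x := by
  induction hn : length x generalizing x with
  | zero =>
    obtain ⟨g, rfl⟩ := (length_eq_zero_iff x).1 hn
    rw [← map_inv, length_of]
  | succ n ih =>
    obtain ⟨g, u, z, rfl, hz⟩ := exists_eq_mul_zpow_t_mul x (by omega)
    have h1 := ih z (by omega)
    have h2 := length_mul_le z⁻¹ (of g * t ^ (u : ℤ))⁻¹
    have h3 : length (of g * t ^ (u : ℤ) : HNNExtension G A B φ)⁻¹ = 1 := by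
      have := length_of_mul_zpow_t (φ := φ) 1 (-u)
      have h4 := length_mul_le (of 1 * t ^ ((-u : ℤˣ) : ℤ)) (of g⁻¹ : HNNExtension G A B φ)
      have h5 := inv_mul_eq (φ := φ) g 1 u 1
      simp only [map_one, mul_one, inv_one, one_mul] at h4 h5 this
      rw [h5]
      rw [length_of] at h4
      have h6 := length_mul_le (t ^ ((-u : ℤˣ) : ℤ) * of g⁻¹) (of g : HNNExtension G A B φ)
      rw [mul_assoc, ← map_mul, inv_mul_cancel, map_one, mul_one, length_of] at h6
      omega
    rw [mul_inv_rev]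
    omega

/-- **Britton's Lemma** for the first vertices on geodesics. -/
theorem mem_toSubgroup_of_length_lt {g : G} {u u' : ℤˣ}
    (h : length (t ^ ((-u : ℤˣ) : ℤ) * (of g * t ^ (u' : ℤ)) : HNNExtension G A B φ) < 2) :
    u = u' ∧ g ∈ toSubgroup A B (-u) := by
  have hc := cancels_of_length_lt (u := -u) (x := (of g * t ^ (u' : ℤ) : HNNExtension G A B φ))
    (by rw [length_of_mul_zpow_t]; exact h)
  rw [mul_smul, of_smul_eq_smul, t_pow_smul_eq_unitsSMul, unitsSMul,
    dif_neg (by simp [Cancels])] at hc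
  have h2 : u = u' := by simpa [Cancels, eq_comm] using hc.2
  subst h2
  have h1 := hc.1
  rw [group_smul_head, cons_head] at h1
  exact ⟨rfl, (Subgroup.mul_mem_cancel_right _ (SetLike.coe_mem _)).1 h1⟩

theorem conj_mem_range {u : ℤˣ} {g : G} (hg : g ∈ toSubgroup A B (-u)) :
    (t ^ ((-u : ℤˣ) : ℤ) * of g * t ^ (u : ℤ) : HNNExtension G A B φ) ∈ (of : G →* _).range := by
  rcases Int.units_eq_one_or u with rfl | rfl
  · refine ⟨φ.symm ⟨g, hg⟩, ?_⟩
    rw [equiv_symm_eq_conj]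
    simp
  · refine ⟨φ ⟨g, hg⟩, ?_⟩
    rw [equiv_eq_conj]
    simp

/-- Uniqueness of the first step is Britton's lemma: `Cancels` reads off the first stable letter of
the normal form and the coset of the associated subgroup before it, which determine the first
vertex. -/
theorem isTreeLength : IsTreeLength (of : G →* HNNExtension G A B φ).range length where
  eq_zero_iff := length_eq_zero_iff
  inv_eq x := le_antisymm (length_inv_le x) (by simpa using length_inv_le x⁻¹)
  mul_le := length_mul_le
  step := length_step
  exists_step y hy := by
    obtain ⟨g, u, z, rfl, hz⟩ := exists_eq_mul_zpow_t_mul y hy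
    exact ⟨of g * t ^ (u : ℤ), length_of_mul_zpow_t g u, by rwa [inv_mul_cancel_left]⟩
  unique_step b b' y hb hb' h h' := by
    obtain ⟨g, u, k, rfl⟩ := exists_of_length_eq_one hb
    obtain ⟨g', u', k', rfl⟩ := exists_of_length_eq_one hb'
    rw [inv_mul_eq, length_of_mul] at h h'
    have hc := cancels_of_length_lt (u := -u) (x := of g⁻¹ * y) (by rw [length_of_mul]; omega)
    have hc' := cancels_of_length_lt (u := -u') (x := of g'⁻¹ * y) (by rw [length_of_mul]; omega)
    rw [mul_smul, of_smul_eq_smul] at hc hc'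
    have huu : u = u' := by
      have h1 := hc.2.symm.trans hc'.2
      simpa using h1
    subst huu
    have hmem : g⁻¹ * g' ∈ toSubgroup A B (-u) := by
      have := mul_mem hc.1 (inv_mem hc'.1)
      simpa [mul_assoc] using this
    obtain ⟨x, hx⟩ := conj_mem_range (φ := φ) hmem
    refine ⟨k⁻¹ * x * k', ?_⟩
    rw [inv_mul_eq, map_mul, map_mul, hx]
    simp [mul_assoc]

/-- The stabilizers of the edges at the base vertex. -/
theorem mem_conj_toSubgroup {g x k : G} {u : ℤˣ}
    (h : (of g * t ^ (u : ℤ) * of k)⁻¹ * of x * (of g * t ^ (u : ℤ) * of k) ∈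
      (of : G →* HNNExtension G A B φ).range) : g⁻¹ * x * g ∈ toSubgroup A B (-u) := by
  rw [← length_eq_zero_iff] at h
  refine (mem_toSubgroup_of_length_lt (φ := φ) (u' := u) ?_).2
  rw [mul_assoc, inv_mul_eq, length_of_mul] at h
  have h1 := length_mul_le (t ^ ((-u : ℤˣ) : ℤ) * (of g⁻¹ * (of x * (of g * t ^ (u : ℤ) * of k))))
    (of k⁻¹ : HNNExtension G A B φ)
  rw [h, length_of] at h1
  have e : t ^ ((-u : ℤˣ) : ℤ) * (of g⁻¹ * (of x * (of g * t ^ (u : ℤ) * of k))) * of k⁻¹ =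
      (t ^ ((-u : ℤˣ) : ℤ) * (of (g⁻¹ * x * g) * t ^ (u : ℤ)) : HNNExtension G A B φ) := by
    simp [mul_assoc]
  rw [e] at h1
  omega

theorem finite_edge_stabilizer [Finite A] [Finite B] (b : HNNExtension G A B φ)
    (hb : length b = 1) :
    {p | p ∈ (of : G →* HNNExtension G A B φ).range ∧ b⁻¹ * p * b ∈ (of : G →* _).range}.Finite := by
  obtain ⟨g, u, k, rfl⟩ := exists_of_length_eq_one hb
  have hfin : (toSubgroup A B (-u) : Set G).Finite := by
    rcases Int.units_eq_one_or u with rfl | rfl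
    · exact Set.toFinite (B : Set G)
    · exact Set.toFinite (A : Set G)
  refine (hfin.image fun a => of (g * a * g⁻¹)).subset ?_
  rintro _ ⟨⟨x, rfl⟩, hx⟩
  exact ⟨_, mem_conj_toSubgroup hx, by group⟩

/-- The exponent sum of the stable letter. -/
def height : HNNExtension G A B φ →* Multiplicative ℤ :=
  lift 1 (Multiplicative.ofAdd 1) (by simp)

theorem isHeight :
    IsTreeLength.IsHeight (of : G →* HNNExtension G A B φ).range length height where
  base := by
    rintro _ ⟨g, rfl⟩
    simp [height]
  step b hb := by
    obtain ⟨g, u, k, rfl⟩ := exists_of_length_eq_one hb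
    rcases Int.units_eq_one_or u with rfl | rfl <;> simp [height]

end HNNExtension

/-! ### Isomorphisms that preserve the base group -/

namespace HNNExtension

variable {G : Type*} [Group G] {H : Subgroup G} {φ ψ : H ≃* H}

theorem toSubgroup_self (u : ℤˣ) : toSubgroup H H u = H := by
  rcases Int.units_eq_one_or u with rfl | rfl <;> rfl

/-- An isomorphism of HNN-extensions of an OE-group with finite associated subgroups can be
modified by an inner automorphism so that it preserves the base group. -/
theorem exists_mulEquiv_of_eq_of {A B A' B' : Subgroup G} {φ : A ≃* B} {ψ : A' ≃* B'}
    [Finite A] [Finite B] [Finite A'] [Finite B']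
    (hG : IsOEGroup G) (θ : HNNExtension G A B φ ≃* HNNExtension G A' B' ψ) :
    ∃ (θ' : HNNExtension G A B φ ≃* HNNExtension G A' B' ψ) (α : MulAut G),
      ∀ g, θ' (of g) = of (α g) := by
  obtain ⟨u, hu⟩ := (isTreeLength (φ := ψ)).exists_fixed_of_isOEGroup isHeight
    finite_edge_stabilizer hG (j := θ.toMonoidHom.comp of) (θ.injective.comp (of_injective _))
  obtain ⟨v, hv⟩ := (isTreeLength (φ := φ)).exists_fixed_of_isOEGroup isHeight
    finite_edge_stabilizer hG (j := θ.symm.toMonoidHom.comp of)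
    (θ.symm.injective.comp (of_injective _))
  let θ₁ : HNNExtension G A B φ ≃* HNNExtension G A' B' ψ := θ.trans (MulAut.conj u⁻¹)
  have hθ₁ : ∀ x, θ₁ x = u⁻¹ * θ x * u := fun x => by simp [θ₁]
  have hle : ∀ g, ∃ g', of g' = θ₁ (of g) := fun g => by
    rw [hθ₁]
    exact hu g
  -- With `z = θ v * u`, conjugation takes the target base into the image of the source base, which
  -- lies in the target base. `conj_mem_of_conj_le` then turns these inclusions into equalities.
  have hz : ∀ g, ∃ g', (θ v * u)⁻¹ * of g * (θ v * u) = θ₁ (of g') := by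
    intro g
    obtain ⟨g', hg'⟩ := hv g
    refine ⟨g', ?_⟩
    rw [hθ₁, hg']
    simp [mul_assoc]
  have hrange : (of : G →* HNNExtension G A B φ).range.map θ₁.toMonoidHom =
      (of : G →* HNNExtension G A' B' ψ).range := by
    ext p
    constructor
    · rintro ⟨_, ⟨g, rfl⟩, rfl⟩
      exact hle g
    · intro hp
      obtain ⟨g, hg⟩ := (isTreeLength (φ := ψ)).conj_mem_of_conj_le finite_edge_stabilizer
        (z := θ v * u) (by
          rintro _ ⟨g, rfl⟩
          obtain ⟨g', hg'⟩ := hz g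
          rw [hg']
          exact hle g') hp
      obtain ⟨g', hg'⟩ := hz g
      refine ⟨of g', ⟨g', rfl⟩, ?_⟩
      change θ₁ (of g') = p
      rw [← hg', hg]
      group
  let α : MulAut G := (MonoidHom.ofInjective (of_injective φ)).trans
    ((θ₁.subgroupMap _).trans ((MulEquiv.subgroupCongr hrange).trans
      (MonoidHom.ofInjective (of_injective ψ)).symm))
  refine ⟨θ₁, α, fun g => ?_⟩
  have h1 := (MonoidHom.ofInjective (of_injective ψ)).apply_symm_apply
    (MulEquiv.subgroupCongr hrange (θ₁.subgroupMap _ (MonoidHom.ofInjective (of_injective φ) g)))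
  have h2 := congrArg Subtype.val h1
  exact h2.symm

/-- If a subgroup of the base group has the order of the edge stabilizers and fixes the vertex
`w`, then it is the stabilizer of the first edge on the geodesic to `w`. -/
theorem mem_iff_conj_mem_of_fixed [Finite H] {w y : HNNExtension G H H ψ} {g₀ : G} {u : ℤˣ}
    (hw : w = of g₀ * t ^ (u : ℤ) * y) (hy : length y + 1 = length w) {Q : Subgroup G}
    (hQ : Nat.card Q = Nat.card H) (hfix : ∀ q ∈ Q, w⁻¹ * of q * w ∈ (of : G →* _).range) (g : G) :
    (g ∈ Q ↔ g₀⁻¹ * g * g₀ ∈ H) ∧ (g ∉ Q → length (w⁻¹ * of g * w) = 2 * length w) := by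
  have hb : length (of g₀ * t ^ (u : ℤ) : HNNExtension G H H ψ) = 1 := length_of_mul_zpow_t _ _
  have hbw : length ((of g₀ * t ^ (u : ℤ))⁻¹ * w) + 1 = length w := by
    rwa [hw, inv_mul_cancel_left, ← hw]
  have hstab : ∀ x, (of g₀ * t ^ (u : ℤ))⁻¹ * of x * (of g₀ * t ^ (u : ℤ)) ∈
      (of : G →* HNNExtension G H H ψ).range → g₀⁻¹ * x * g₀ ∈ H := by
    intro x hx
    have := mem_conj_toSubgroup (φ := ψ) (g := g₀) (x := x) (k := 1) (u := u)
      (by simpa only [map_one, mul_one] using hx)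
    rwa [toSubgroup_self] at this
  have hQH : ∀ q ∈ Q, g₀⁻¹ * q * g₀ ∈ H := by
    intro q hq
    refine hstab q ?_
    by_contra hne
    have h1 := isTreeLength.two_mul_of_step hb hbw ⟨q, rfl⟩ hne
    have h2 := (length_eq_zero_iff _).2 (hfix q hq)
    omega
  have hle : Q.map (MulAut.conj g₀⁻¹).toMonoidHom ≤ H := by
    rintro _ ⟨q, hq, rfl⟩
    simpa [MulAut.conj_apply] using hQH q hq
  have heq : Q.map (MulAut.conj g₀⁻¹).toMonoidHom = H := by
    refine Subgroup.eq_of_le_of_card_ge hle ?_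
    rw [Subgroup.card_map_of_injective (MulAut.conj g₀⁻¹).injective, hQ]
  have hiff : g ∈ Q ↔ g₀⁻¹ * g * g₀ ∈ H := by
    refine ⟨hQH g, fun hg => ?_⟩
    rw [← heq] at hg
    obtain ⟨q, hq, hqg⟩ := hg
    have : q = g := by simpa [MulAut.conj_apply] using hqg
    rwa [← this]
  refine ⟨hiff, fun hg => isTreeLength.two_mul_of_step hb hbw ⟨g, rfl⟩ fun hmem => hg ?_⟩
  exact hiff.2 (hstab g hmem)

section Equiv

variable (θ : HNNExtension G H H φ ≃* HNNExtension G H H ψ) {α : MulAut G}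
  (hθ : ∀ g, θ (of g) = of (α g))

include hθ

omit hθ in
theorem of_zpow_apply (u : ℤˣ) (h : H) :
    (of ((((ψ : MulAut H) ^ (u : ℤ)) h : H) : G) : HNNExtension G H H ψ) =
      t ^ (u : ℤ) * of (h : G) * (t ^ (u : ℤ))⁻¹ := by
  rcases Int.units_eq_one_or u with rfl | rfl
  · simpa using equiv_eq_conj (φ := ψ) h
  · simpa using equiv_symm_eq_conj (φ := ψ) h

/-- Otherwise the height would vanish on the whole image of `θ`, which contains `t`. -/
theorem height_map_t_ne_one : height (θ t) ≠ 1 := by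
  intro h
  have h1 : (height (φ := ψ)).comp θ.toMonoidHom = 1 := by
    refine hom_ext ?_ h
    ext g
    change Multiplicative.toAdd (height (θ (of g))) = _
    rw [hθ, isHeight.base _ ⟨_, rfl⟩]
    rfl
  have h2 := DFunLike.congr_fun h1 (θ.symm t)
  have h3 : height (t : HNNExtension G H H ψ) = 1 := by simpa using h2
  simp [height] at h3

theorem map_t_mul_of (h : H) : θ t * of (α h) * (θ t)⁻¹ = of (α (φ h)) := by
  rw [← hθ, ← hθ, equiv_eq_conj, map_mul, map_mul, map_inv]

theorem map_t_inv_mul_of (h : H) : (θ t)⁻¹ * of (α (φ h)) * θ t = of (α h) := by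
  rw [← map_t_mul_of θ hθ]
  group

/-- For equal exponents, elements `θ t * of g` change heights, hence are hyperbolic. For opposite
exponents, `α(H)` fixes the vertices of `θ t` and its inverse and has the order of an edge
stabilizer; an element of the base outside `α(H)` therefore moves the first edge, and the length
doubles. -/
theorem length_map_mul_map [Finite H] (x : G) (u u' : ℤˣ) (hu : u = u' ∨ x ∉ H) :
    length (θ t) < length (θ (t ^ (u : ℤ) * of x * t ^ (u' : ℤ))) := by
  have hτ := height_map_t_ne_one θ hθ
  have hpos : 0 < length (θ t) := by
    rw [Nat.pos_iff_ne_zero]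
    intro h0
    exact hτ (isHeight.base _ ((length_eq_zero_iff _).1 h0))
  have hlt : ∀ g : G, length (θ t) < length (θ t * of g * θ t) := by
    intro g
    have h1 := (isTreeLength (φ := ψ)).lt_length_mul_self isHeight (w := θ t * of g)
      (by rwa [map_mul, isHeight.base _ ⟨g, rfl⟩, mul_one])
    rwa [isTreeLength.mul_right _ ⟨g, rfl⟩, ← mul_assoc,
      isTreeLength.mul_right _ ⟨g, rfl⟩] at h1
  have hcard : Nat.card (H.map α.toMonoidHom) = Nat.card H :=
    Subgroup.card_map_of_injective α.injective
  have hnot : x ∉ H → α x ∉ H.map α.toMonoidHom := by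
    rintro hx ⟨y, hy, hyx⟩
    exact hx (α.injective hyx ▸ hy)
  rw [map_mul, map_mul, map_zpow, map_zpow, hθ]
  rcases Int.units_eq_one_or u with rfl | rfl <;> rcases Int.units_eq_one_or u' with rfl | rfl
  · simpa using hlt (α x)
  · have hx := hnot (hu.resolve_left (by decide))
    obtain ⟨g₀, v, y, hy, hy'⟩ := exists_eq_mul_zpow_t_mul (θ t)⁻¹
      (by rwa [isTreeLength.inv_eq])
    have := (mem_iff_conj_mem_of_fixed hy hy' hcard (by
      rintro _ ⟨h, hh, rfl⟩
      exact ⟨_, (by rw [inv_inv]; exact map_t_mul_of θ hθ ⟨h, hh⟩ : _ = _).symm⟩) (α x)).2 hx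
    rw [inv_inv, isTreeLength.inv_eq] at this
    simp only [Units.val_one, zpow_one, Units.val_neg, zpow_neg]
    omega
  · have hx := hnot (hu.resolve_left (by decide))
    obtain ⟨g₀, v, y, hy, hy'⟩ := exists_eq_mul_zpow_t_mul (θ t) hpos
    have := (mem_iff_conj_mem_of_fixed hy hy' hcard (by
      rintro _ ⟨h, hh, rfl⟩
      refine ⟨_, (map_t_inv_mul_of θ hθ (φ.symm ⟨h, hh⟩)).symm.trans ?_⟩
      rw [φ.apply_symm_apply]
      rfl) (α x)).2 hx
    simp only [Units.val_one, zpow_one, Units.val_neg, zpow_neg]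
    omega
  · have := hlt (α x⁻¹)
    rw [← isTreeLength.inv_eq (θ t * _ * _)] at this
    simpa [mul_assoc] using this

/-- The path through the images of the prefixes of a reduced word makes too little backtracking at
each turn to come back, by `length_map_mul_map`. The induction also carries that prepending a
syllable does not shorten the image. -/
theorem length_map_t_le [Finite H] (x : HNNExtension G H H φ) (hx : 0 < length x) :
    length (θ t) ≤ length (θ x) := by
  have hP : ∀ g, θ (of g) ∈ (of : G →* HNNExtension G H H ψ).range := fun g => ⟨_, (hθ g).symm⟩
  have hzpow : ∀ (u : ℤˣ), length (θ (t ^ (u : ℤ))) = length (θ t) := by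
    intro u
    rcases Int.units_eq_one_or u with rfl | rfl
    · simp
    · simp [isTreeLength.inv_eq]
  have key : ∀ (n : ℕ) (g : G) (u : ℤˣ) (y : HNNExtension G H H φ), length y = n →
      length (of g * t ^ (u : ℤ) * y) = n + 1 →
      length (θ t) ≤ length (θ (of g * t ^ (u : ℤ) * y)) ∧
      length (θ y) ≤ length (θ (of g * t ^ (u : ℤ) * y)) := by
    intro n
    induction n with
    | zero =>
      intro g u y hy _
      obtain ⟨k, rfl⟩ := (length_eq_zero_iff y).1 hy
      rw [map_mul, map_mul, isTreeLength.mul_right _ (hP k), isTreeLength.mul_left (hP g), hzpow,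
        (length_eq_zero_iff _).2 (hP k)]
      exact ⟨le_rfl, Nat.zero_le _⟩
    | succ n ih =>
      intro g u y hy hgy
      obtain ⟨k, v, z, rfl, hz⟩ := exists_eq_mul_zpow_t_mul y (by omega)
      have hred : u = v ∨ k ∉ H := by
        by_contra hne
        push Not at hne
        have hv : v = -u := (Int.units_ne_iff_eq_neg.1 hne.1.symm)
        have hm := conj_mem_range (φ := φ) (u := v) (g := k)
          (by rw [toSubgroup_self]; exact hne.2)
        rw [hv, neg_neg] at hm
        have h1 := isTreeLength.mul_left hm z
        rw [hv, mul_assoc (of g), length_of_mul,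
          show t ^ (u : ℤ) * (of k * t ^ ((-u : ℤˣ) : ℤ) * z) =
            t ^ (u : ℤ) * of k * t ^ ((-u : ℤˣ) : ℤ) * z by simp only [mul_assoc], h1] at hgy
        omega
      obtain ⟨ih1, ih2⟩ := ih k v z (by omega) (by omega)
      have hturn := length_map_mul_map θ hθ k u v hred
      rw [mul_assoc (of g), map_mul, isTreeLength.mul_left (hP g)]
      -- Write `k t^v z` for the tail. The maximum cannot be `ℓ(θ z) + ℓ(θ t)`, since the turn is
      -- longer than `θ t` and the tail at least as long as `θ z`; the other term bounds the whole
      -- word from below by the tail.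
      have h4 := isTreeLength.four_point 1 (θ (t ^ (u : ℤ) * of k * t ^ (v : ℤ)))
        (θ (t ^ (u : ℤ) * (of k * t ^ (v : ℤ) * z))) (θ (t ^ (u : ℤ)))
      simp only [← map_inv, ← map_mul] at h4
      have e1 : (t ^ (u : ℤ))⁻¹ * (t ^ (u : ℤ) * (of k * t ^ (v : ℤ) * z)) =
        (of k * t ^ (v : ℤ) * z : HNNExtension G H H φ) := by group
      have e2 : (t ^ (u : ℤ))⁻¹ * (t ^ (u : ℤ) * of k * t ^ (v : ℤ)) =
        (of k * t ^ (v : ℤ) : HNNExtension G H H φ) := by group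
      have e3 : (t ^ (u : ℤ) * of k * t ^ (v : ℤ))⁻¹ *
        (t ^ (u : ℤ) * (of k * t ^ (v : ℤ) * z)) = (z : HNNExtension G H H φ) := by group
      rw [e1, e2, e3, inv_one, one_mul, one_mul, mul_one, map_inv, isTreeLength.inv_eq, hzpow,
        map_mul θ (of k), isTreeLength.mul_left (hP k), hzpow] at h4
      omega
  obtain ⟨g, u, y, rfl, hy⟩ := exists_eq_mul_zpow_t_mul x hx
  exact (key _ g u y rfl hy.symm).1

/-- The preimage of `t` is outside the base, so `length_map_t_le` applies to it and gives `length (θ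
t) ≤ length t = 1`. -/
theorem length_map_t [Finite H] : length (θ t) = 1 := by
  have ht : length (t : HNNExtension G H H ψ) = 1 := by
    simpa using length_of_mul_zpow_t (φ := ψ) 1 1
  have h1 : 0 < length (θ.symm t) := by
    rw [Nat.pos_iff_ne_zero]
    intro h0
    obtain ⟨g, hg⟩ := (length_eq_zero_iff _).1 h0
    have : (t : HNNExtension G H H ψ) = of (α g) := by rw [← hθ, hg, θ.apply_symm_apply]
    rw [this, length_of] at ht
    omega
  have h2 := length_map_t_le θ hθ _ h1
  rw [θ.apply_symm_apply, ht] at h2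
  have h3 : length (θ t) ≠ 0 := fun h0 =>
    height_map_t_ne_one θ hθ (isHeight.base _ ((length_eq_zero_iff _).1 h0))
  omega

/-- The relation between the gluing automorphisms of isomorphic HNN-extensions. -/
theorem exists_eq_of_mulEquiv [Finite H] :
    ∃ β ∈ autBar H, ∃ ν ∈ H.normalizerMonoidHom.range, ∃ u : ℤˣ,
      ν = (ψ : MulAut H) ^ (u : ℤ) * (β * φ * β⁻¹) := by
  obtain ⟨g₀, u, g₁, hw⟩ := exists_of_length_eq_one (length_map_t θ hθ)
  -- `α(H)` fixes the vertex of `θ t`, so by its order it is the stabilizer of the edge leading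
  -- there, which is `g₀Hg₀⁻¹`.
  have hmem : ∀ g, g ∈ H.map α.toMonoidHom ↔ g₀⁻¹ * g * g₀ ∈ H := by
    intro g
    refine (mem_iff_conj_mem_of_fixed hw (by rw [length_of, length_map_t θ hθ])
      (Subgroup.card_map_of_injective α.injective) ?_ g).1
    rintro _ ⟨h, hh, rfl⟩
    refine ⟨_, (map_t_inv_mul_of θ hθ (φ.symm ⟨h, hh⟩)).symm.trans ?_⟩
    rw [φ.apply_symm_apply]
    rfl
  have hH : H.map (MulAut.conj g₀⁻¹ * α : MulAut G).toMonoidHom = H := by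
    ext x
    constructor
    · rintro ⟨h, hh, rfl⟩
      have := (hmem (α h)).1 ⟨h, hh, rfl⟩
      simpa [MulAut.conj_apply] using this
    · intro hx
      obtain ⟨h, hh, hhx⟩ := (hmem (g₀ * x * g₀⁻¹)).2 (by simpa [mul_assoc] using hx)
      refine ⟨h, hh, ?_⟩
      change α h = _ at hhx
      simp [hhx, mul_assoc]
  let β : MulAut H := ((MulAut.conj g₀⁻¹ * α : MulAut G).subgroupMap H).trans
    (MulEquiv.subgroupCongr hH)
  have hβ : ∀ h : H, (β h : G) = g₀⁻¹ * α h * g₀ := fun h => by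
    change (MulAut.conj g₀⁻¹ * α : MulAut G) h = _
    simp
  have hconj : ∀ h : H, (g₁ * g₀) * (h : G) * (g₁ * g₀)⁻¹ =
      (((ψ : MulAut H) ^ ((-u : ℤˣ) : ℤ) * (β * φ * β⁻¹)) h : H) := by
    intro h
    apply of_injective ψ
    have h1 := map_t_mul_of θ hθ (β⁻¹ h)
    rw [hw] at h1
    have h2 : (of (β (φ (β⁻¹ h)) : G) : HNNExtension G H H ψ) =
        of g₀⁻¹ * of (α (φ (β⁻¹ h))) * of g₀ := by rw [hβ, map_mul, map_mul]
    have h3 : (h : G) = g₀⁻¹ * α (β⁻¹ h) * g₀ := by rw [← hβ, MulAut.apply_inv_self]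
    rw [MulAut.mul_apply, MulAut.mul_apply, MulAut.mul_apply, of_zpow_apply, h2, ← h1]
    conv_lhs => rw [h3]
    simp [mul_assoc]
  have hn : g₁ * g₀ ∈ Subgroup.normalizer (H : Set G) := by
    rw [Subgroup.mem_normalizer_iff]
    intro x
    refine ⟨fun hx => ?_, fun hx => ?_⟩
    · rw [hconj ⟨x, hx⟩]
      exact SetLike.coe_mem _
    · have h1 := hconj (((ψ : MulAut H) ^ ((-u : ℤˣ) : ℤ) * (β * φ * β⁻¹))⁻¹ ⟨_, hx⟩)
      rw [MulAut.apply_inv_self] at h1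
      have h2 := mul_left_cancel (mul_right_cancel h1)
      rw [← h2]
      exact SetLike.coe_mem _
  refine ⟨β, ⟨MulAut.conj g₀⁻¹ * α, fun h => rfl⟩, _, ⟨⟨_, hn⟩, rfl⟩, -u, ?_⟩
  ext h
  exact hconj h

end Equiv

end HNNExtension

/-! ### Constructing isomorphisms of HNN-extensions -/

namespace HNNExtension

variable {G : Type*} [Group G]

/-- The homomorphism of HNN-extensions that is `α` on the base group and sends `t` to `kt`. -/
def mapMul {A B A' B' : Subgroup G} {f : A ≃* B} {f' : A' ≃* B'} (α : MulAut G) (k : G)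
    (h : ∀ a : A, ∃ a' : A', (a' : G) = α a ∧ α (f a) = k * f' a' * k⁻¹) :
    HNNExtension G A B f →* HNNExtension G A' B' f' :=
  lift (of.comp α.toMonoidHom) (of k * t) fun a => by
    obtain ⟨a', h1, h2⟩ := h a
    change of k * t * of (α a) = of (α (f a)) * (of k * t)
    rw [← h1, h2, mul_assoc, t_mul_of]
    simp [mul_assoc]

/-- HNN-extensions whose data correspond under an automorphism of the base group, up to an inner
automorphism, are isomorphic. -/
theorem nonempty_mulEquiv_of_mulAut {A B A' B' : Subgroup G} {f : A ≃* B} {f' : A' ≃* B'}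
    (α : MulAut G) (k : G) (e : A ≃* A') (he : ∀ a, (e a : G) = α a)
    (hf : ∀ a, α (f a) = k * f' (e a) * k⁻¹) :
    Nonempty (HNNExtension G A B f ≃* HNNExtension G A' B' f') := by
  refine ⟨MonoidHom.toMulEquiv (mapMul α k fun a => ⟨e a, he a, hf a⟩)
    (mapMul α⁻¹ (α⁻¹ k⁻¹) fun a => ⟨e.symm a, ?_, ?_⟩) ?_ ?_⟩
  · rw [← MulAut.inv_apply_self G α (e.symm a : G), ← he, e.apply_symm_apply]
  · apply α.injective
    simp [hf, mul_assoc]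
  · ext
    · simp [mapMul]
    · simp [mapMul]
  · ext
    · simp [mapMul]
    · simp [mapMul]

/-- The homomorphism of HNN-extensions that inverts the stable letter. -/
def invStable {A B : Subgroup G} (f : A ≃* B) (f' : B ≃* A) (h : ∀ a, f' (f a) = a) :
    HNNExtension G A B f →* HNNExtension G B A f' :=
  lift of t⁻¹ fun a => by
    have := equiv_eq_conj (φ := f') (f a)
    rw [h] at this
    rw [this]
    group

theorem nonempty_mulEquiv_symm {A B : Subgroup G} (f : A ≃* B) :
    Nonempty (HNNExtension G A B f ≃* HNNExtension G B A f.symm) :=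
  ⟨MonoidHom.toMulEquiv (invStable f f.symm f.symm_apply_apply)
    (invStable f.symm f f.apply_symm_apply) (by ext <;> simp [invStable])
    (by ext <;> simp [invStable])⟩

end HNNExtension

/-! ### The orbit relation of the twisted permutations -/

section Orbits

variable {Q : Type*} [Group Q] {N A : Subgroup Q}

theorem orbitRel_twistedPerms_mul {n : Q} (hn : n ∈ N) (x : Q) :
    MulAction.orbitRel (twistedPerms N A) Q (n * x) x :=
  ⟨⟨Equiv.mulLeft n, Subgroup.subset_closure (Or.inl (Or.inl ⟨n, hn, rfl⟩))⟩, rfl⟩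

theorem orbitRel_twistedPerms_conj {a : Q} (ha : a ∈ A) (x : Q) :
    MulAction.orbitRel (twistedPerms N A) Q (a * x * a⁻¹) x :=
  ⟨⟨(MulAut.conj a).toEquiv, Subgroup.subset_closure (Or.inl (Or.inr ⟨a, ha, rfl⟩))⟩, rfl⟩

theorem orbitRel_twistedPerms_inv (x : Q) :
    MulAction.orbitRel (twistedPerms N A) Q x⁻¹ x :=
  ⟨⟨Equiv.inv Q, Subgroup.subset_closure (Or.inr rfl)⟩, rfl⟩

/-- The orbit relation is the smallest equivalence relation that contains the moves. -/
theorem orbitRel_twistedPerms_le (r : Setoid Q) (hN : ∀ n ∈ N, ∀ x, r (n * x) x)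
    (hA : ∀ a ∈ A, ∀ x, r (a * x * a⁻¹) x) (hinv : ∀ x, r x⁻¹ x) :
    MulAction.orbitRel (twistedPerms N A) Q ≤ r := by
  have key : ∀ p ∈ twistedPerms N A, ∀ x, r (p x) x := by
    intro p hp
    induction hp using Subgroup.closure_induction with
    | mem p hp =>
      rcases hp with (⟨n, hn, rfl⟩ | ⟨a, ha, rfl⟩) | rfl
      · exact hN n hn
      · exact hA a ha
      · exact hinv
    | one => exact fun x => r.refl x
    | mul p q _ _ hp hq => exact fun x => r.trans (hp (q x)) (hq x)
    | inv p _ hp => exact fun x => r.symm (by simpa using hp (p⁻¹ x))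
  rintro x y ⟨⟨p, hp⟩, rfl⟩
  exact key p hp y

end Orbits

/-! ### Comparison with `Out(H)` and the count -/

section

variable {G : Type*} [Group G] {H : Subgroup G}

/-- The outer class of an automorphism. -/
abbrev outClass (H : Subgroup G) (φ : MulAut H) : OutAut H := QuotientGroup.mk' _ φ

/-- If `φ` is `ψ` after conjugation by `h₀`, then `t ↦ ψ(h₀)t` is an isomorphism. -/
theorem nonempty_mulEquiv_of_outClass_eq {φ ψ : MulAut H} (h : outClass H φ = outClass H ψ) :
    Nonempty (HNNExtension G H H φ ≃* HNNExtension G H H ψ) := by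
  obtain ⟨h₀, hh⟩ := QuotientGroup.eq.1 h.symm
  refine HNNExtension.nonempty_mulEquiv_of_mulAut 1 (ψ h₀ : G) (MulEquiv.refl _)
    (fun _ => rfl) fun a => ?_
  have : φ = ψ * MulAut.conj h₀ := by rw [hh, mul_inv_cancel_left]
  rw [this]
  simp [MulAut.conj_apply]

/-- The relation on `Out(H)` of defining isomorphic HNN-extensions. -/
def outSetoid (H : Subgroup G) : Setoid (OutAut H) where
  r x y := ∀ φ ψ : MulAut H, outClass H φ = x → outClass H ψ = y →
    Nonempty (HNNExtension G H H φ ≃* HNNExtension G H H ψ)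
  iseqv :=
    ⟨fun _ _ _ h h' => nonempty_mulEquiv_of_outClass_eq (h.trans h'.symm),
      fun h φ ψ hφ hψ => ⟨(h ψ φ hψ hφ).some.symm⟩,
      fun {_ y _} h h' φ ψ hφ hψ => by
        obtain ⟨χ, hχ⟩ := QuotientGroup.mk'_surjective _ y
        exact ⟨(h φ χ hφ hχ).some.trans (h' χ ψ hχ hψ).some⟩⟩

theorem outSetoid_of {φ ψ : MulAut H}
    (h : Nonempty (HNNExtension G H H φ ≃* HNNExtension G H H ψ)) :
    outSetoid H (outClass H φ) (outClass H ψ) := fun _ _ hφ hψ =>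
  ⟨(nonempty_mulEquiv_of_outClass_eq hφ).some.trans
    (h.some.trans (nonempty_mulEquiv_of_outClass_eq hψ).some.symm)⟩

theorem orbitRel_le_outSetoid :
    MulAction.orbitRel (twistedPerms (normalizerTilde H) (autTilde H)) (OutAut H) ≤
      outSetoid H := by
  refine orbitRel_twistedPerms_le _ ?_ ?_ ?_
  · rintro _ ⟨_, ⟨n, rfl⟩, rfl⟩ x
    obtain ⟨φ, rfl⟩ := QuotientGroup.mk'_surjective _ x
    rw [← map_mul]
    exact outSetoid_of (HNNExtension.nonempty_mulEquiv_of_mulAut 1 (n : G) (MulEquiv.refl _)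
      (fun _ => rfl) fun a => rfl)
  · rintro _ ⟨β, ⟨α, hα⟩, rfl⟩ x
    obtain ⟨φ, rfl⟩ := QuotientGroup.mk'_surjective _ x
    rw [← map_mul, ← map_inv, ← map_mul]
    refine (outSetoid H).symm (outSetoid_of (HNNExtension.nonempty_mulEquiv_of_mulAut α 1 β
      (fun a => (hα a).symm) fun a => ?_))
    rw [hα]
    simp
  · intro x
    obtain ⟨φ, rfl⟩ := QuotientGroup.mk'_surjective _ x
    rw [← map_inv]
    exact (outSetoid H).symm (outSetoid_of (HNNExtension.nonempty_mulEquiv_symm φ))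

theorem orbitRel_of_mulEquiv (hG : IsOEGroup G) [Finite H] {φ ψ : MulAut H}
    (θ : HNNExtension G H H φ ≃* HNNExtension G H H ψ) :
    MulAction.orbitRel (twistedPerms (normalizerTilde H) (autTilde H)) (OutAut H)
      (outClass H φ) (outClass H ψ) := by
  obtain ⟨θ', α, hθ'⟩ := HNNExtension.exists_mulEquiv_of_eq_of hG θ
  obtain ⟨β, hβ, ν, hν, u, h⟩ := HNNExtension.exists_eq_of_mulEquiv θ' hθ'
  set R := MulAction.orbitRel (twistedPerms (normalizerTilde H) (autTilde H)) (OutAut H)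
  have hνN : outClass H ν ∈ normalizerTilde H := ⟨ν, hν, rfl⟩
  have hβA : outClass H β ∈ autTilde H := ⟨β, hβ, rfl⟩
  have hconj := orbitRel_twistedPerms_conj (N := normalizerTilde H) hβA (outClass H φ)
  have h' : outClass H ν = outClass H ψ ^ (u : ℤ) *
      (outClass H β * outClass H φ * (outClass H β)⁻¹) := by
    rw [h]
    simp only [map_mul, map_zpow, map_inv]
  generalize outClass H β * outClass H φ * (outClass H β)⁻¹ = z at *
  have hz : z = (outClass H ψ ^ (u : ℤ))⁻¹ * outClass H ν := by rw [h', inv_mul_cancel_left]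
  have h1 : R z (outClass H ψ ^ (u : ℤ)) := by
    -- In `z` the class of `ν` is a right factor, while only left multiplications are available;
    -- inversion moves it to the left.
    have h2 := orbitRel_twistedPerms_inv (N := normalizerTilde H) (A := autTilde H) z
    have h3 := orbitRel_twistedPerms_mul (A := autTilde H) (inv_mem hνN)
      (outClass H ψ ^ (u : ℤ))
    rw [hz, mul_inv_rev, inv_inv, ← hz] at h2
    exact R.trans (R.symm h2) h3
  have h4 : R (outClass H ψ ^ (u : ℤ)) (outClass H ψ) := by
    rcases Int.units_eq_one_or u with rfl | rfl
    · rw [Units.val_one, zpow_one]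
    · rw [Units.val_neg, Units.val_one, zpow_neg, zpow_one]
      exact orbitRel_twistedPerms_inv _
  exact R.trans (R.symm hconj) (R.trans h1 h4)

end

theorem mainTheorem2 {G₁ : Type*} [Group G₁] (hG₁ : IsOEGroup G₁) (H K : Subgroup G₁) [Finite H]
    (hHK : ∃ g : G₁, H.map (MulAut.conj g).toMonoidHom = K) :
    Nat.card (HNNIsoClasses H K) =
      Nat.card (TwistedOrbits (normalizerTilde H) (autTilde H)) := by
  obtain ⟨g, rfl⟩ := hHK
  let c : H ≃* H.map (MulAut.conj g).toMonoidHom := (MulAut.conj g).subgroupMap H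
  have hc : ∀ h : H, (c h : G₁) = g * h * g⁻¹ := fun h => rfl
  -- Replacing the stable letter by `g * t` turns `f` into an automorphism of `H`.
  have hiso : ∀ f : H ≃* H.map (MulAut.conj g).toMonoidHom,
      Nonempty (HNNExtension G₁ H _ f ≃* HNNExtension G₁ H H (f.trans c.symm)) := fun f =>
    HNNExtension.nonempty_mulEquiv_of_mulAut 1 g (MulEquiv.refl _) (fun _ => rfl) fun a => by
      rw [← hc]
      exact congrArg Subtype.val (c.apply_symm_apply (f a)).symm
  have hrel : ∀ f₁ f₂ : H ≃* H.map (MulAut.conj g).toMonoidHom,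
      hnnIsoSetoid H _ f₁ f₂ ↔
      MulAction.orbitRel (twistedPerms (normalizerTilde H) (autTilde H)) (OutAut H)
        (outClass H (f₁.trans c.symm)) (outClass H (f₂.trans c.symm)) := by
    intro f₁ f₂
    constructor
    · rintro ⟨θ⟩
      exact orbitRel_of_mulEquiv hG₁ ((hiso f₁).some.symm.trans (θ.trans (hiso f₂).some))
    · intro h
      obtain ⟨θ⟩ := orbitRel_le_outSetoid h _ _ rfl rfl
      exact ⟨(hiso f₁).some.trans (θ.trans (hiso f₂).some.symm)⟩
  refine Nat.card_eq_of_bijective (Quotient.map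
    (fun f : H ≃* H.map (MulAut.conj g).toMonoidHom => outClass H (f.trans c.symm))
    fun f₁ f₂ h => (hrel f₁ f₂).1 h) ⟨?_, ?_⟩
  · rintro ⟨f₁⟩ ⟨f₂⟩ h
    exact Quotient.sound ((hrel f₁ f₂).2 (Quotient.exact h))
  · rintro ⟨x⟩
    obtain ⟨φ, rfl⟩ := QuotientGroup.mk'_surjective _ x
    refine ⟨Quotient.mk _ (MulEquiv.trans φ c), ?_⟩
    refine congrArg (Quotient.mk _) (congrArg (QuotientGroup.mk' _) ?_)
    ext h
    exact congrArg Subtype.val (c.symm_apply_apply (φ h))
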